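/- Let $n\ge 1$ and let $\mathcal L\subset\mathbb R^n$ be an $n$-dimensional lattice, i.e. a discrete subgroup of $\mathbb R^n$ whose linear span is $\mathbb R^n$. Let $$\mathcal V=\{x\in\mathbb R^n:\ \|x\|_2\le\|x-y\|_2\ \text{ for all } y\in\mathcal L\setminus\{0\}\}$$ be its Voronoi cell, and let $\|x\|_{\mathcal V}=\inf\{s\ge 0: x\in s\mathcal V\}$ be the Voronoi norm. A vector $v\in\mathcal L\setminus\{0\}$ is called Voronoi relevant if it induces a facet of $\mathcal V$, i.e. if $\mathcal V\cap\{x:\langle x,v\rangle=\tfrac12\langle v,v\rangle\}$ is nonempty of affine dimension $n-1$. The Voronoi graph $\mathcal G$ of $\mathcal L$ has vertex set $\mathcal L$, with $x,y\in\mathcal L$ adjacent if and only if the cells $x+\mathcal V$ and $y+\mathcal V$ share a facet, equivalently if $x-y$ is Voronoi relevant. Let $d_{\mathcal G}$ be the shortest path distance on $\mathcal G$. Then any two points $x,y\in\mathcal L$ are joined by a path in $\mathcal G$, and $$\tfrac12\|x-y\|_{\mathcal V}\ \le\ d_{\mathcal G}(x,y)\ \le\ \tfrac n2\|x-y\|_{\mathcal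 V}.$$ Moreover, for every $n\ge1$ both bounds are tight on $\mathcal L=\mathbb Z^n$: there are distinct points $x,y\in\mathbb Z^n$ with $d_{\mathcal G}(x,y)=\tfrac12\|x-y\|_{\mathcal V}$, and there are distinct points $x,y\in\mathbb Z^n$ with $d_{\mathcal G}(x,y)=\tfrac n2\|x-y\|_{\mathcal V}$. -/

import Mathlib

open scoped RealInnerProductSpace

/-- The (closed) Voronoi cell of a lattice `L` in `ℝⁿ`: the points that are at least as close to `0`
as to every other lattice point. -/
def voronoiCell {n : ℕ} (L : Submodule ℤ (EuclideanSpace ℝ (Fin n))) :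
    Set (EuclideanSpace ℝ (Fin n)) :=
  {x | ∀ y ∈ L, y ≠ 0 → ‖x‖ ≤ ‖x - y‖}

/-- The part of the Voronoi cell that lies on the bisecting hyperplane `⟨x, v⟩ = ⟨v, v⟩ / 2` of
`0` and `v`. -/
def voronoiFace {n : ℕ} (L : Submodule ℤ (EuclideanSpace ℝ (Fin n)))
    (v : EuclideanSpace ℝ (Fin n)) : Set (EuclideanSpace ℝ (Fin n)) :=
  voronoiCell L ∩ {x | ⟪x, v⟫ = ⟪v, v⟫ / 2}

/-- The Voronoi relevant vectors: the nonzero lattice vectors inducing a facet of the Voronoi cell,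
that is, a (nonempty) face of affine dimension `n - 1`. -/
def voronoiRelevant {n : ℕ} (L : Submodule ℤ (EuclideanSpace ℝ (Fin n))) :
    Set (EuclideanSpace ℝ (Fin n)) :=
  {v | v ∈ L ∧ v ≠ 0 ∧ (voronoiFace L v).Nonempty ∧
    Module.finrank ℝ (vectorSpan ℝ (voronoiFace L v)) + 1 = n}

theorem neg_voronoiFace {n : ℕ} (L : Submodule ℤ (EuclideanSpace ℝ (Fin n)))
    (v : EuclideanSpace ℝ (Fin n)) : voronoiFace L (-v) = -voronoiFace L v := by
  ext x
  simp only [voronoiFace, voronoiCell, Set.mem_inter_iff, Set.mem_ofPred_eq, Set.mem_neg,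
    inner_neg_right, inner_neg_left, neg_neg, norm_neg]
  refine and_congr_left fun _ => ⟨fun h y hy hy0 => ?_, fun h y hy hy0 => ?_⟩
  · have := h (-y) (L.neg_mem hy) (neg_ne_zero.mpr hy0)
    rwa [← norm_neg (x - -y), show -(x - -y) = -x - y by abel] at this
  · have := h (-y) (L.neg_mem hy) (neg_ne_zero.mpr hy0)
    rwa [← norm_neg (-x - -y), show -(-x - -y) = x - y by abel] at this

theorem neg_mem_voronoiRelevant {n : ℕ} (L : Submodule ℤ (EuclideanSpace ℝ (Fin n)))
    {v : EuclideanSpace ℝ (Fin n)} (hv : v ∈ voronoiRelevant L) : -v ∈ voronoiRelevant L := by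
  obtain ⟨h1, h2, h3, h4⟩ := hv
  refine ⟨L.neg_mem h1, neg_ne_zero.mpr h2, ?_, ?_⟩
  · rw [neg_voronoiFace]; exact h3.neg
  · have : vectorSpan ℝ (voronoiFace L (-v)) = vectorSpan ℝ (voronoiFace L v) := by
      have hs : -voronoiFace L v -ᵥ -voronoiFace L v = voronoiFace L v -ᵥ voronoiFace L v := by
        ext z
        simp only [Set.mem_vsub, vsub_eq_sub, Set.mem_neg]
        constructor
        · rintro ⟨a, ha, b, hb, rfl⟩
          exact ⟨-b, hb, -a, ha, by abel⟩
        · rintro ⟨a, ha, b, hb, rfl⟩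
          exact ⟨-b, by simpa using hb, -a, by simpa using ha, by abel⟩
      rw [neg_voronoiFace, vectorSpan, vectorSpan, hs]
    rw [this]; exact h4

/-- The Voronoi graph of `L`: the vertices are the lattice points, and two of them are adjacent iff
their Voronoi cells share a facet, i.e. iff their difference is Voronoi relevant. -/
def voronoiGraph {n : ℕ} (L : Submodule ℤ (EuclideanSpace ℝ (Fin n))) : SimpleGraph L where
  Adj x y := (x : EuclideanSpace ℝ (Fin n)) - (y : EuclideanSpace ℝ (Fin n)) ∈ voronoiRelevant L
  symm := ⟨fun x y h => by
    rw [← neg_sub]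
    exact neg_mem_voronoiRelevant L h⟩
  loopless := ⟨fun x h => h.2.1 (sub_self _)⟩

/-- The Voronoi norm `‖x‖_𝒱 = inf {s : x ∈ s 𝒱}`, the smallest scaling of the cell containing `x`.
(`gauge` takes the infimum over `s > 0`; allowing `s = 0` as well does not change it, because
`0 • 𝒱 = {0}` and `gauge` vanishes at `0`.) -/
noncomputable def voronoiNorm {n : ℕ} (L : Submodule ℤ (EuclideanSpace ℝ (Fin n)))
    (x : EuclideanSpace ℝ (Fin n)) : ℝ :=
  gauge (voronoiCell L) x

/-- The lattice `ℤⁿ` in `ℝⁿ`, the integer span of the standard basis. -/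
abbrev integerLattice (n : ℕ) : Submodule ℤ (EuclideanSpace ℝ (Fin n)) :=
  Submodule.span ℤ (Set.range (EuclideanSpace.basisFun (Fin n) ℝ).toBasis)

/-!
Fix lattice points `x`, `y` and put `u = y - x`. Each Voronoi relevant `v` has `v / 2` in the cell
`𝒱`, because its facet is symmetric about `v / 2`; so every edge has Voronoi norm at most `2`, and
the triangle inequality along a walk gives the lower bound.

For the upper bound, let `Z` be uniform in `𝒱` and follow the segment from `Z` to `Z + u` in `N`
steps of size `w = u / N`. A step leaves the current cell with the same probability at every stage,
because the event is periodic and the translates of `𝒱` are fundamental domains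
(`volume_voronoiCell_inter_crossingSet_translate`). If `u ∈ b • 𝒱` and `ε = b / N`, then `𝒱` and
`𝒱 - w` both contain a translate of `(1 - ε / 2) • 𝒱`, so by Bernoulli's inequality this
probability is at most `1 - (1 - ε / 2) ^ n ≤ n ε / 2` (`volume_crossingSet_le`). The expected
number of steps that leave a cell is therefore at most `n b / 2`, whatever `N` is.

The segment through a generic `Z` avoids the pairwise intersections of cells that are not facets:
these are countably many sets of dimension at most `n - 2`, and sweeping them along `u` gives a null
set (`ae_line_generic`). By compactness and local finiteness of the tiling, for large `N` each step
then stays in its cell or enters one sharing a facet with it (`exists_step_adjacent`), so the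
crossings trace out a walk from `x` to `y` (`ae_eventually_exists_walk`). Thus the graph distance
is almost surely at most the limit inferior of the crossing counts, and Fatou's lemma bounds it by
`n b / 2` (`dist_le_of_sub_mem_smul`).

In `ℤⁿ` the cell is the cube `|pᵢ| ≤ 1 / 2` and a relevant vector has a single nonzero coordinate,
equal to `1` or `-1`. The lower bound is attained at a basis vector, the upper bound at the all-ones
vector, both of Voronoi norm `2`.
-/

open scoped RealInnerProductSpace

/-! ### Geometry of the Voronoi cell -/

section Cell

variable {n : ℕ} {L : Submodule ℤ (EuclideanSpace ℝ (Fin n))}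

theorem mem_voronoiCell_iff_inner {x : EuclideanSpace ℝ (Fin n)} :
    x ∈ voronoiCell L ↔ ∀ y ∈ L, 2 * ⟪x, y⟫ ≤ ⟪y, y⟫ := by
  have key : ∀ y : EuclideanSpace ℝ (Fin n), ‖x‖ ≤ ‖x - y‖ ↔ 2 * ⟪x, y⟫ ≤ ⟪y, y⟫ := fun y => by
    rw [← sq_le_sq₀ (norm_nonneg _) (norm_nonneg _), norm_sub_sq_real,
      real_inner_self_eq_norm_sq]
    constructor <;> intro h <;> linarith
  constructor
  · intro h y hy
    rcases eq_or_ne y 0 with rfl | hy0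
    · simp
    · exact (key y).1 (h y hy hy0)
  · exact fun h y hy _ => (key y).2 (h y hy)

theorem mem_voronoiCell_iff_norm {x : EuclideanSpace ℝ (Fin n)} :
    x ∈ voronoiCell L ↔ ∀ y ∈ L, ‖x‖ ≤ ‖x - y‖ := by
  refine ⟨fun h y hy => ?_, fun h y hy _ => h y hy⟩
  rcases eq_or_ne y 0 with rfl | hy0
  · simp
  · exact h y hy hy0

theorem neg_mem_voronoiCell {x : EuclideanSpace ℝ (Fin n)} (hx : x ∈ voronoiCell L) :
    -x ∈ voronoiCell L := by
  rw [mem_voronoiCell_iff_inner] at hx ⊢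
  intro y hy
  simpa using hx (-y) (L.neg_mem hy)

theorem convex_voronoiCell : Convex ℝ (voronoiCell L) := by
  intro x hx z hz a b ha hb hab
  rw [mem_voronoiCell_iff_inner] at hx hz ⊢
  intro y hy
  rw [inner_add_left, real_inner_smul_left, real_inner_smul_left]
  have h1 := mul_le_mul_of_nonneg_left (hx y hy) ha
  have h2 := mul_le_mul_of_nonneg_left (hz y hy) hb
  calc 2 * (a * ⟪x, y⟫ + b * ⟪z, y⟫) = a * (2 * ⟪x, y⟫) + b * (2 * ⟪z, y⟫) := by ring
    _ ≤ a * ⟪y, y⟫ + b * ⟪y, y⟫ := add_le_add h1 h2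
    _ = ⟪y, y⟫ := by rw [← add_mul, hab, one_mul]

theorem isClosed_voronoiCell : IsClosed (voronoiCell L) := by
  have : voronoiCell L = ⋂ y ∈ L, {x | 2 * ⟪x, y⟫ ≤ ⟪y, y⟫} := by
    ext x; simp [mem_voronoiCell_iff_inner]
  rw [this]
  refine isClosed_biInter fun y _ => isClosed_le (by fun_prop) continuous_const

/-- Points of the cell that stay in it after subtracting a lattice vector lie on the corresponding
bisecting hyperplane. -/
theorem mem_voronoiFace_iff {v p : EuclideanSpace ℝ (Fin n)} (hv : v ∈ L) :
    p ∈ voronoiFace L v ↔ p ∈ voronoiCell L ∧ p - v ∈ voronoiCell L := by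
  have hvv : ⟪v, v⟫ = ‖v‖ ^ 2 := real_inner_self_eq_norm_sq v
  refine and_congr_right fun hp => ?_
  rw [mem_voronoiCell_iff_inner] at hp ⊢
  rw [Set.mem_ofPred_eq]
  constructor
  · intro h y hy
    have h1 := hp (v + y) (L.add_mem hv hy)
    rw [inner_sub_left]
    simp only [inner_add_left, inner_add_right] at h1
    rw [real_inner_comm v y] at h1
    linarith
  · intro h
    have h1 := hp v hv
    have h2 := h (-v) (L.neg_mem hv)
    simp only [inner_sub_left, inner_neg_right, inner_neg_left, neg_neg] at h2
    linarith

/-- The midpoint of `0` and a Voronoi relevant vector `v` lies in the cell: the facet of `v` is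
symmetric about `v / 2`. -/
theorem half_mem_voronoiCell {v : EuclideanSpace ℝ (Fin n)} (hv : v ∈ voronoiRelevant L) :
    (1 / 2 : ℝ) • v ∈ voronoiCell L := by
  obtain ⟨hvL, -, ⟨p, hp⟩, -⟩ := hv
  obtain ⟨h1, h2⟩ := (mem_voronoiFace_iff hvL).1 hp
  have := convex_voronoiCell h1 (neg_mem_voronoiCell h2) (a := 1 / 2) (b := 1 / 2)
    (by norm_num) (by norm_num) (by norm_num)
  convert this using 1
  module

theorem voronoiNorm_le_two {v : EuclideanSpace ℝ (Fin n)}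
    (hv : (1 / 2 : ℝ) • v ∈ voronoiCell L) : voronoiNorm L v ≤ 2 :=
  gauge_le_of_mem (by norm_num) ⟨_, hv, by simp [smul_smul]⟩

theorem vectorSpan_voronoiFace_le (v : EuclideanSpace ℝ (Fin n)) :
    vectorSpan ℝ (voronoiFace L v) ≤ (ℝ ∙ v)ᗮ := by
  rw [vectorSpan, Submodule.span_le]
  rintro _ ⟨a, ⟨-, ha⟩, b, ⟨-, hb⟩, rfl⟩
  rw [Set.mem_ofPred_eq] at ha hb
  rw [SetLike.mem_coe, Submodule.mem_orthogonal_singleton_iff_inner_left]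
  change ⟪a - b, v⟫ = 0
  rw [inner_sub_left, ha, hb, sub_self]

theorem finrank_orthogonal_singleton_add_one {v : EuclideanSpace ℝ (Fin n)} (hv : v ≠ 0) :
    Module.finrank ℝ (ℝ ∙ v)ᗮ + 1 = n := by
  have h := Submodule.finrank_add_finrank_orthogonal (ℝ ∙ v)
  rw [finrank_span_singleton hv, finrank_euclideanSpace_fin] at h
  omega

section Discrete

variable [DiscreteTopology L]

theorem finite_lattice_inter_closedBall (p : EuclideanSpace ℝ (Fin n)) (r : ℝ) :
    (Metric.closedBall p r ∩ (L : Set (EuclideanSpace ℝ (Fin n)))).Finite := by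
  change (_ ∩ (L.toAddSubgroup : Set (EuclideanSpace ℝ (Fin n)))).Finite
  have : DiscreteTopology L.toAddSubgroup := ‹DiscreteTopology L›
  exact Metric.finite_isBounded_inter_isClosed DiscreteTopology.isDiscrete
    Metric.isBounded_closedBall AddSubgroup.isClosed_of_discrete

/-- The translates of the cell by the lattice cover the space: a closest lattice point exists. -/
theorem exists_sub_mem_voronoiCell (p : EuclideanSpace ℝ (Fin n)) :
    ∃ c ∈ L, p - c ∈ voronoiCell L := by
  obtain ⟨c, ⟨hc1, hc2⟩, hc⟩ := Set.exists_min_image _ (fun c => ‖p - c‖)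
    (finite_lattice_inter_closedBall (L := L) p ‖p‖) ⟨0, by simp, L.zero_mem⟩
  refine ⟨c, hc2, mem_voronoiCell_iff_norm.2 fun y hy => ?_⟩
  rw [sub_sub]
  by_cases h : ‖p - (c + y)‖ ≤ ‖p‖
  · exact hc _ ⟨by rwa [Metric.mem_closedBall, dist_comm, dist_eq_norm], L.add_mem hc2 hy⟩
  · rw [Metric.mem_closedBall, dist_comm, dist_eq_norm] at hc1
    linarith

/-- Local finiteness of the tiling: the cells meeting a small ball about `p` all contain `p`. -/
theorem exists_ball_sub_mem_voronoiCell (p : EuclideanSpace ℝ (Fin n)) :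
    ∃ ε > 0, ∀ q ∈ Metric.ball p ε, ∀ c ∈ L, q - c ∈ voronoiCell L → p - c ∈ voronoiCell L := by
  -- A cell meeting the unit ball about `p` has its centre within `‖p‖ + 2` of `p`.
  have hSf := finite_lattice_inter_closedBall (L := L) p (‖p‖ + 2)
  have hU : ∀ᶠ q in nhds p, ∀ c ∈ Metric.closedBall p (‖p‖ + 2) ∩
      (L : Set (EuclideanSpace ℝ (Fin n))), p - c ∉ voronoiCell L → q - c ∉ voronoiCell L := by
    refine (Filter.eventually_all_finite hSf).2 fun c _ => ?_
    by_cases hpc : p - c ∈ voronoiCell L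
    · exact Filter.Eventually.of_forall fun q h => absurd hpc h
    · have : ContinuousAt (fun q : EuclideanSpace ℝ (Fin n) => q - c) p := by fun_prop
      filter_upwards [this.preimage_mem_nhds (isClosed_voronoiCell.isOpen_compl.mem_nhds hpc)]
        with q hq _ using hq
  obtain ⟨ε, hε, hεU⟩ := Metric.eventually_nhds_iff_ball.1 hU
  refine ⟨min ε 1, by positivity, fun q hq c hc hqc => ?_⟩
  by_contra hpc
  have hq' : dist q p < 1 := (Metric.mem_ball.1 hq).trans_le (min_le_right _ _)
  refine hεU q (Metric.ball_subset_ball (min_le_left _ _) hq) c ⟨?_, hc⟩ hpc hqc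
  have h1 := mem_voronoiCell_iff_norm.1 hqc (-c) (L.neg_mem hc)
  rw [sub_neg_eq_add, sub_add_cancel] at h1
  have h2 : ‖q‖ ≤ ‖p‖ + dist q p := by
    rw [dist_eq_norm]; simpa using norm_add_le p (q - p)
  have h3 : dist c p ≤ ‖q - c‖ + dist q p := by
    rw [← dist_eq_norm, dist_comm q c]; exact dist_triangle _ _ _
  rw [Metric.mem_closedBall]
  linarith

theorem voronoiCell_mem_nhds_zero : voronoiCell L ∈ nhds (0 : EuclideanSpace ℝ (Fin n)) := by
  obtain ⟨ε, hε, h⟩ := exists_ball_sub_mem_voronoiCell (L := L) 0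
  refine Filter.mem_of_superset (Metric.ball_mem_nhds 0 hε) fun q hq => ?_
  obtain ⟨c, hc, hqc⟩ := exists_sub_mem_voronoiCell (L := L) q
  have h0 := h q hq c hc hqc
  -- `0 - c` lies in the cell, so it is no longer than `0 - c + c = 0`.
  have h1 := mem_voronoiCell_iff_norm.1 h0 (-c) (L.neg_mem hc)
  have : c = 0 := by simpa using h1
  simpa [this] using hqc

theorem absorbent_voronoiCell : Absorbent ℝ (voronoiCell L) :=
  absorbent_nhds_zero voronoiCell_mem_nhds_zero

theorem voronoiNorm_le_two_mul_length {x y : L} (p : (voronoiGraph L).Walk x y) :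
    voronoiNorm L ((x : EuclideanSpace ℝ (Fin n)) - y) ≤ 2 * p.length := by
  induction p with
  | nil => simp [voronoiNorm]
  | @cons x z y h p ih =>
    have h1 : voronoiNorm L ((x : EuclideanSpace ℝ (Fin n)) - z) ≤ 2 :=
      voronoiNorm_le_two (half_mem_voronoiCell h)
    have h2 := gauge_add_le (convex_voronoiCell (L := L)) absorbent_voronoiCell
      ((x : EuclideanSpace ℝ (Fin n)) - z) (z - y)
    rw [sub_add_sub_cancel] at h2
    unfold voronoiNorm at *
    rw [SimpleGraph.Walk.length_cons]
    push_cast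
    linarith

end Discrete

end Cell

/-! ### Null sets attached to the faces -/

section Measure

open MeasureTheory Filter
open scoped ENNReal Pointwise

variable {n : ℕ} {L : Submodule ℤ (EuclideanSpace ℝ (Fin n))}

theorem volume_eq_zero_of_sub_mem {W : Submodule ℝ (EuclideanSpace ℝ (Fin n))} (hW : W ≠ ⊤)
    (p₀ : EuclideanSpace ℝ (Fin n)) {S : Set (EuclideanSpace ℝ (Fin n))}
    (hS : ∀ p ∈ S, p - p₀ ∈ W) : volume S = 0 := by
  refine measure_mono_null (t := (AffineSubspace.mk' p₀ W : Set _)) (fun p hp => ?_)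
    (Measure.addHaar_affineSubspace _ _ fun h => hW ?_)
  · exact AffineSubspace.mem_mk'.2 (hS p hp)
  · rw [← AffineSubspace.direction_mk' p₀ W, h, AffineSubspace.direction_top]

theorem volume_voronoiFace_translate {v : EuclideanSpace ℝ (Fin n)} (hv : v ≠ 0)
    (a : EuclideanSpace ℝ (Fin n)) : volume {p | p - a ∈ voronoiFace L v} = 0 := by
  rcases (voronoiFace L v).eq_empty_or_nonempty with h | ⟨q, hq⟩
  · simp [h]
  refine volume_eq_zero_of_sub_mem (W := (ℝ ∙ v)ᗮ) (fun h => ?_) (q + a) fun p hp => ?_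
  · have h1 := finrank_orthogonal_singleton_add_one hv
    rw [h, finrank_top, finrank_euclideanSpace_fin] at h1
    omega
  · rw [show p - (q + a) = (p - a) - q by abel]
    exact vectorSpan_voronoiFace_le v (vsub_mem_vectorSpan ℝ hp hq)

/-- Sweeping a face of dimension at most `n - 2` along a line gives a null set. -/
theorem volume_sweep_voronoiFace {v : EuclideanSpace ℝ (Fin n)} (hvL : v ∈ L) (hv : v ≠ 0)
    (hr : v ∉ voronoiRelevant L) (a u : EuclideanSpace ℝ (Fin n)) :
    volume {p | ∃ t : ℝ, p + t • u - a ∈ voronoiFace L v} = 0 := by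
  rcases (voronoiFace L v).eq_empty_or_nonempty with h | ⟨q, hq⟩
  · simp [h]
  refine volume_eq_zero_of_sub_mem (W := vectorSpan ℝ (voronoiFace L v) ⊔ (ℝ ∙ u)) (fun h => ?_)
    (q + a) ?_
  · have h1 := finrank_orthogonal_singleton_add_one hv
    have h2 := Submodule.finrank_mono (vectorSpan_voronoiFace_le (L := L) v)
    have h3 := Submodule.finrank_add_le_finrank_add_finrank
      (vectorSpan ℝ (voronoiFace L v)) (ℝ ∙ u)
    have h4 := finrank_span_le_card (R := ℝ) ({u} : Set (EuclideanSpace ℝ (Fin n)))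
    rw [Set.toFinset_singleton, Finset.card_singleton] at h4
    rw [h, finrank_top, finrank_euclideanSpace_fin] at h3
    exact hr ⟨hvL, hv, ⟨q, hq⟩, by omega⟩
  · rintro p ⟨t, ht⟩
    rw [show p - (q + a) = (p + t • u - a - q) + (-t) • u by module]
    exact Submodule.add_mem_sup (vsub_mem_vectorSpan ℝ ht hq)
      (Submodule.smul_mem _ _ (Submodule.mem_span_singleton_self u))

/-! ### Crossings along a discrete path -/

/-- The points `p` that leave some cell containing them under the step `p ↦ p + w`. -/
def crossingSet (L : Submodule ℤ (EuclideanSpace ℝ (Fin n))) (w : EuclideanSpace ℝ (Fin n)) :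
    Set (EuclideanSpace ℝ (Fin n)) :=
  {p | ∃ c ∈ L, p - c ∈ voronoiCell L ∧ p + w - c ∉ voronoiCell L}

theorem add_mem_crossingSet_iff {w p c : EuclideanSpace ℝ (Fin n)} (hc : c ∈ L) :
    c + p ∈ crossingSet L w ↔ p ∈ crossingSet L w := by
  constructor
  · rintro ⟨d, hd, h1, h2⟩
    refine ⟨d - c, L.sub_mem hd hc, ?_, fun h => h2 ?_⟩
    · convert h1 using 1; abel
    · convert h using 1; abel
  · rintro ⟨d, hd, h1, h2⟩
    refine ⟨c + d, L.add_mem hc hd, ?_, fun h => h2 ?_⟩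
    · convert h1 using 1; abel
    · convert h using 1; abel

/-- If `w` has Voronoi norm at most `ε`, then the cell and its translate by `-w` both contain the
copy of the cell shrunk by the factor `1 - ε / 2` and centred at `-w / 2`. -/
theorem smul_voronoiCell_subset {w : EuclideanSpace ℝ (Fin n)} {ε : ℝ} (hε : 0 ≤ ε) (hε2 : ε ≤ 2)
    (hw : w ∈ ε • voronoiCell L) :
    (fun p => p + (1 / 2 : ℝ) • w) ⁻¹' ((1 - ε / 2) • voronoiCell L) ⊆
      voronoiCell L ∩ {p | p + w ∈ voronoiCell L} := by
  obtain ⟨v, hv, rfl⟩ := hw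
  rintro p ⟨z, hz, hzp⟩
  have hp : p = (1 - ε / 2) • z - (ε / 2) • v := by
    rw [eq_sub_iff_add_eq]
    simp only [smul_smul] at hzp
    rw [hzp]
    congr 2
    ring
  have h0 : 0 ≤ 1 - ε / 2 := by linarith
  constructor
  · convert convex_voronoiCell hz (neg_mem_voronoiCell hv) h0 (show 0 ≤ ε / 2 by linarith)
      (by ring) using 1
    rw [hp]; module
  · rw [Set.mem_ofPred_eq]
    convert convex_voronoiCell hz hv h0 (show 0 ≤ ε / 2 by linarith) (by ring) using 1
    rw [hp]; module

/-- The number of steps, among the first `k` ones, at which the discrete path `Z, Z + w, Z + 2w, …`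
leaves a cell, as a function of the starting point `Z`. -/
noncomputable def crossingCount (L : Submodule ℤ (EuclideanSpace ℝ (Fin n)))
    (w : EuclideanSpace ℝ (Fin n)) (k : ℕ) (Z : EuclideanSpace ℝ (Fin n)) : ℝ≥0∞ :=
  ∑ j ∈ Finset.range k, {p | p + (j : ℝ) • w ∈ crossingSet L w}.indicator 1 Z

section Discrete

variable [DiscreteTopology L]

/-- If the steps of the discrete path `Z + k w` move only between equal or adjacent cells, the
cells visited yield a walk whose length is at most the number of crossings. -/
theorem exists_walk_length_le_crossingCount {Z w : EuclideanSpace ℝ (Fin n)}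
    (hZ : Z ∈ voronoiCell L) (x : L) (N : ℕ)
    (hadj : ∀ k < N, ∀ c ∈ L, ∀ c' ∈ L, Z + (k : ℝ) • w - c ∈ voronoiCell L →
      Z + ((k + 1 : ℕ) : ℝ) • w - c' ∈ voronoiCell L → c ≠ c' → c - c' ∈ voronoiRelevant L) :
    ∀ k ≤ N, ∃ y : L, Z + (k : ℝ) • w - ((y : EuclideanSpace ℝ (Fin n)) - x) ∈ voronoiCell L ∧
      ∃ p : (voronoiGraph L).Walk x y, (p.length : ℝ≥0∞) ≤ crossingCount L w k Z := by
  intro k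
  induction k with
  | zero => exact fun _ => ⟨x, by simpa using hZ, SimpleGraph.Walk.nil, by simp⟩
  | succ k ih =>
    intro hk
    obtain ⟨y, hy, p, hp⟩ := ih (by omega)
    have hcount : crossingCount L w (k + 1) Z = crossingCount L w k Z +
        {p | p + (k : ℝ) • w ∈ crossingSet L w}.indicator 1 Z := Finset.sum_range_succ _ _
    by_cases hstay : Z + ((k + 1 : ℕ) : ℝ) • w - ((y : EuclideanSpace ℝ (Fin n)) - x) ∈
        voronoiCell L
    · exact ⟨y, hstay, p, hp.trans (hcount ▸ le_self_add)⟩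
    have hcross : Z ∈ {p | p + (k : ℝ) • w ∈ crossingSet L w} := by
      refine ⟨_, L.sub_mem y.2 x.2, hy, fun h => hstay ?_⟩
      convert h using 2
      push_cast
      module
    obtain ⟨c', hc', h'⟩ := exists_sub_mem_voronoiCell (L := L) (Z + ((k + 1 : ℕ) : ℝ) • w)
    have hne : (y : EuclideanSpace ℝ (Fin n)) - x ≠ c' := fun h => hstay (h ▸ h')
    have hrel := hadj k (by omega) _ (L.sub_mem y.2 x.2) c' hc' hy h' hne
    have hyx : (voronoiGraph L).Adj y (x + ⟨c', hc'⟩) := by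
      change (y : EuclideanSpace ℝ (Fin n)) - (x + c') ∈ voronoiRelevant L
      rwa [← sub_sub]
    refine ⟨x + ⟨c', hc'⟩, by simpa using h', p.concat hyx, ?_⟩
    rw [SimpleGraph.Walk.length_concat, hcount, Set.indicator_of_mem hcross]
    push_cast
    exact add_le_add_left hp 1

/-- Two nearby points of a generic line lie in equal or adjacent cells: by local finiteness, all
cells meeting a short enough piece of the line contain a common point of it. -/
theorem exists_step_adjacent {Z u : EuclideanSpace ℝ (Fin n)}
    (hZ : ∀ t : ℝ, ∀ c ∈ L, ∀ c' ∈ L, Z + t • u - c ∈ voronoiCell L →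
      Z + t • u - c' ∈ voronoiCell L → c ≠ c' → c - c' ∈ voronoiRelevant L) :
    ∃ δ > 0, ∀ s ∈ Set.Icc (0 : ℝ) 1, ∀ t : ℝ, |t - s| < δ → ∀ c ∈ L, ∀ c' ∈ L,
      Z + s • u - c ∈ voronoiCell L → Z + t • u - c' ∈ voronoiCell L → c ≠ c' →
      c - c' ∈ voronoiRelevant L := by
  choose ε hε hball using fun τ : ℝ => exists_ball_sub_mem_voronoiCell (L := L) (Z + τ • u)
  have hcont : Continuous fun t : ℝ => Z + t • u := by fun_prop
  obtain ⟨δ, hδ, h⟩ := lebesgue_number_lemma_of_metric (isCompact_Icc (a := (0 : ℝ)) (b := 1))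
    (c := fun τ : ℝ => (fun t : ℝ => Z + t • u) ⁻¹' Metric.ball (Z + τ • u) (ε τ))
    (fun τ => Metric.isOpen_ball.preimage hcont)
    (fun τ _ => Set.mem_iUnion.2 ⟨τ, Metric.mem_ball_self (hε τ)⟩)
  refine ⟨δ, hδ, fun s hs t hst c hc c' hc' h1 h2 hne => ?_⟩
  obtain ⟨τ, hτ⟩ := h s hs
  exact hZ τ c hc c' hc' (hball τ _ (hτ (Metric.mem_ball_self hδ)) c hc h1)
    (hball τ _ (hτ (by rwa [Metric.mem_ball, Real.dist_eq])) c' hc' h2) hne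

/-! ### The cell as a fundamental domain -/

theorem isAddFundamentalDomain_voronoiCell_translate (a : EuclideanSpace ℝ (Fin n)) :
    IsAddFundamentalDomain L {p | p - a ∈ voronoiCell L} (volume : Measure _) where
  nullMeasurableSet := (isClosed_voronoiCell.preimage
    (continuous_id.sub continuous_const)).measurableSet.nullMeasurableSet
  ae_covers := Eventually.of_forall fun p => by
    obtain ⟨c, hc, h⟩ := exists_sub_mem_voronoiCell (L := L) (p - a)
    refine ⟨-(⟨c, hc⟩ : L), ?_⟩
    have : (-(⟨c, hc⟩ : L)) +ᵥ p = -c + p := rfl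
    rw [Set.mem_ofPred_eq, this]
    convert h using 1
    abel
  aedisjoint := fun c c' hne => by
    have hne' : (c' : EuclideanSpace ℝ (Fin n)) - c ≠ 0 :=
      sub_ne_zero.2 fun h => hne (Subtype.ext h.symm)
    refine measure_mono_null ?_ (volume_voronoiFace_translate (L := L) hne' (a + c))
    rintro p ⟨⟨q, hq, hqp⟩, ⟨q', hq', hqp'⟩⟩
    have h1 : (c : EuclideanSpace ℝ (Fin n)) + q = p := hqp
    have h2 : (c' : EuclideanSpace ℝ (Fin n)) + q' = p := hqp'
    rw [Set.mem_ofPred_eq] at hq hq' ⊢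
    rw [mem_voronoiFace_iff (L.sub_mem c'.2 c.2)]
    constructor
    · convert hq using 1
      rw [← h1]; abel
    · convert hq' using 1
      rw [← h2]; abel

theorem isAddFundamentalDomain_voronoiCell :
    IsAddFundamentalDomain L (voronoiCell L) (volume : Measure _) := by
  simpa using isAddFundamentalDomain_voronoiCell_translate (L := L) 0

instance vaddInvariantMeasure_lattice (L : Submodule ℤ (EuclideanSpace ℝ (Fin n))) :
    VAddInvariantMeasure L (EuclideanSpace ℝ (Fin n)) volume :=
  ⟨fun c s _ => measure_preimage_add volume (c : EuclideanSpace ℝ (Fin n)) s⟩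

theorem volume_voronoiCell_ne_zero : volume (voronoiCell L) ≠ 0 :=
  (Measure.measure_pos_of_mem_nhds volume voronoiCell_mem_nhds_zero).ne'

end Discrete

/-! ### Generic lines -/

section Lattice

variable [DiscreteTopology L] [IsZLattice ℝ L]

/-- For almost every starting point `Z`, the line `Z + ℝ u` meets two cells at the same time only
where these share a facet. -/
theorem ae_line_generic (u : EuclideanSpace ℝ (Fin n)) :
    ∀ᵐ Z : EuclideanSpace ℝ (Fin n), ∀ t : ℝ, ∀ c ∈ L, ∀ c' ∈ L, Z + t • u - c ∈ voronoiCell L →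
      Z + t • u - c' ∈ voronoiCell L → c ≠ c' → c - c' ∈ voronoiRelevant L := by
  have key : ∀ᵐ Z : EuclideanSpace ℝ (Fin n), ∀ c c' : L, (c : EuclideanSpace ℝ (Fin n)) ≠ c' →
      (c : EuclideanSpace ℝ (Fin n)) - c' ∉ voronoiRelevant L →
      ¬ ∃ t : ℝ, Z + t • u - c' ∈ voronoiFace L ((c : EuclideanSpace ℝ (Fin n)) - c') := by
    refine ae_all_iff.2 fun c => ae_all_iff.2 fun c' => ?_
    by_cases h : (c : EuclideanSpace ℝ (Fin n)) ≠ c' ∧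
      (c : EuclideanSpace ℝ (Fin n)) - c' ∉ voronoiRelevant L
    · have := volume_sweep_voronoiFace (L.sub_mem c.2 c'.2) (sub_ne_zero.2 h.1) h.2 c' u
      filter_upwards [measure_eq_zero_iff_ae_notMem.1 this] with Z hZ _ _ using hZ
    · exact Eventually.of_forall fun Z h1 h2 => absurd ⟨h1, h2⟩ h
  filter_upwards [key] with Z hZ t c hc c' hc' h1 h2 hne
  by_contra hr
  refine hZ ⟨c, hc⟩ ⟨c', hc'⟩ hne hr ⟨t, (mem_voronoiFace_iff (L.sub_mem hc hc')).2 ⟨h2, ?_⟩⟩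
  rwa [sub_sub_sub_cancel_right]

theorem ae_notMem_voronoiFace :
    ∀ᵐ Z : EuclideanSpace ℝ (Fin n), ∀ v ∈ L, v ≠ 0 → Z ∉ voronoiFace L v := by
  have key : ∀ᵐ Z : EuclideanSpace ℝ (Fin n), ∀ v : L, (v : EuclideanSpace ℝ (Fin n)) ≠ 0 →
      Z ∉ voronoiFace L (v : EuclideanSpace ℝ (Fin n)) := by
    refine ae_all_iff.2 fun v => ?_
    by_cases h : (v : EuclideanSpace ℝ (Fin n)) = 0
    · exact Eventually.of_forall fun Z h1 => absurd h h1
    · have := volume_voronoiFace_translate (L := L) h 0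
      filter_upwards [measure_eq_zero_iff_ae_notMem.1 this] with Z hZ _
      simpa using hZ
  filter_upwards [key] with Z hZ v hv using hZ ⟨v, hv⟩

theorem volume_voronoiCell_ne_top : volume (voronoiCell L) ≠ ∞ := by
  have := ZLattice.module_free ℝ L
  have b := Module.Free.chooseBasis ℤ L
  rw [(isAddFundamentalDomain_voronoiCell (L := L)).measure_eq
    (ZLattice.isAddFundamentalDomain b volume)]
  exact (ZSpan.fundamentalDomain_isBounded _).measure_lt_top.ne

/-! ### Probability of leaving a cell in one step -/

theorem measurableSet_crossingSet (w : EuclideanSpace ℝ (Fin n)) :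
    MeasurableSet (crossingSet L w) := by
  have : crossingSet L w =
      ⋃ c : L, {p | p - (c : EuclideanSpace ℝ (Fin n)) ∈ voronoiCell L} ∩
        {p | p + w - (c : EuclideanSpace ℝ (Fin n)) ∈ voronoiCell L}ᶜ := by
    ext p
    simp [crossingSet, and_left_comm]
  rw [this]
  refine MeasurableSet.iUnion fun c => MeasurableSet.inter ?_ (MeasurableSet.compl ?_)
  · exact (isClosed_voronoiCell.preimage (continuous_id.sub continuous_const)).measurableSet
  · exact (isClosed_voronoiCell.preimage
      ((continuous_id.add continuous_const).sub continuous_const)).measurableSet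

/-- As the crossing set is periodic, a uniform point of the cell keeps the same probability of
lying in it after any translation. -/
theorem volume_voronoiCell_inter_crossingSet_translate (w a : EuclideanSpace ℝ (Fin n)) :
    volume ({p | p + a ∈ crossingSet L w} ∩ voronoiCell L) =
      volume (crossingSet L w ∩ voronoiCell L) := by
  rw [(isAddFundamentalDomain_voronoiCell (L := L)).measure_set_eq
    (isAddFundamentalDomain_voronoiCell_translate (L := L) a) (measurableSet_crossingSet w)
    (fun c => Set.ext fun p => add_mem_crossingSet_iff c.2),
    ← measure_preimage_add_right volume a (_ ∩ {p | p - a ∈ voronoiCell L})]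
  congr 1
  ext p
  simp

theorem volume_crossingSet_le_diff (w : EuclideanSpace ℝ (Fin n)) :
    volume (crossingSet L w ∩ voronoiCell L) ≤
      volume (voronoiCell L \ {p | p + w ∈ voronoiCell L}) := by
  refine measure_mono_ae ?_
  filter_upwards [ae_notMem_voronoiFace (L := L)] with Z hZ
  rintro ⟨⟨c, hc, h1, h2⟩, h⟩
  have hc0 : c = 0 := by
    by_contra hc0
    exact hZ c hc hc0 ((mem_voronoiFace_iff hc).2 ⟨h, h1⟩)
  refine ⟨h, ?_⟩
  simpa [hc0] using h2

theorem volume_crossingSet_le {w : EuclideanSpace ℝ (Fin n)} {ε : ℝ} (hε : 0 ≤ ε) (hε2 : ε ≤ 2)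
    (hw : w ∈ ε • voronoiCell L) :
    volume (crossingSet L w ∩ voronoiCell L) ≤
      ENNReal.ofReal (n * (ε / 2)) * volume (voronoiCell L) := by
  set V := voronoiCell L
  have hV : MeasurableSet {p | p + w ∈ V} :=
    (isClosed_voronoiCell.preimage (continuous_id.add continuous_const)).measurableSet
  have h0 : 0 ≤ 1 - ε / 2 := by linarith
  have hshrink : ENNReal.ofReal ((1 - ε / 2) ^ n) * volume V ≤
      volume (V ∩ {p | p + w ∈ V}) := by
    refine le_trans (le_of_eq ?_) (measure_mono (smul_voronoiCell_subset hε hε2 hw))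
    rw [measure_preimage_add_right, Measure.addHaar_smul, finrank_euclideanSpace_fin,
      abs_of_nonneg (pow_nonneg h0 n)]
  have hbern : 1 - n * (ε / 2) ≤ (1 - ε / 2) ^ n := by
    have := one_add_mul_le_pow (a := -(ε / 2)) (by linarith) n
    rw [← sub_eq_add_neg] at this
    linarith
  refine (volume_crossingSet_le_diff w).trans ?_
  have hsplit := measure_inter_add_sdiff (μ := volume) V hV
  have hVt : volume V ≠ ∞ := volume_voronoiCell_ne_top
  have hfin : volume (V ∩ {p | p + w ∈ V}) ≠ ∞ := ne_top_of_le_ne_top hVt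
    (measure_mono Set.inter_subset_left)
  refine (ENNReal.add_le_add_iff_left hfin).1 ?_
  rw [hsplit]
  refine le_trans ?_ (add_le_add_left hshrink _)
  rw [← add_mul, ← ENNReal.ofReal_add (pow_nonneg h0 n) (by positivity)]
  refine le_mul_of_one_le_left zero_le ?_
  rw [ENNReal.one_le_ofReal]
  linarith

/-! ### The expected number of crossings along a segment -/

theorem measurableSet_add_mem_crossingSet (w a : EuclideanSpace ℝ (Fin n)) :
    MeasurableSet {p | p + a ∈ crossingSet L w} :=
  (measurableSet_crossingSet w).preimage (measurable_id.add_const a)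

theorem measurable_crossingCount (w : EuclideanSpace ℝ (Fin n)) (k : ℕ) :
    Measurable (crossingCount L w k) :=
  Finset.measurable_fun_sum _ fun _ _ =>
    measurable_one.indicator (measurableSet_add_mem_crossingSet _ _)

theorem lintegral_crossingCount (w : EuclideanSpace ℝ (Fin n)) (k : ℕ) :
    ∫⁻ Z in voronoiCell L, crossingCount L w k Z =
      k * volume (crossingSet L w ∩ voronoiCell L) := by
  unfold crossingCount
  rw [lintegral_finsetSum _ fun _ _ =>
    measurable_one.indicator (measurableSet_add_mem_crossingSet _ _)]
  simp_rw [lintegral_indicator_one (measurableSet_add_mem_crossingSet _ _),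
    Measure.restrict_apply (measurableSet_add_mem_crossingSet _ _),
    volume_voronoiCell_inter_crossingSet_translate]
  simp

theorem ae_eventually_exists_walk (x y : L) :
    ∀ᵐ Z ∂(volume.restrict (voronoiCell L)), ∀ᶠ N : ℕ in atTop,
      ∃ p : (voronoiGraph L).Walk x y, (p.length : ℝ≥0∞) ≤
        crossingCount L ((N : ℝ)⁻¹ • ((y : EuclideanSpace ℝ (Fin n)) - x)) N Z := by
  set u := (y : EuclideanSpace ℝ (Fin n)) - x with hu
  filter_upwards [ae_restrict_mem isClosed_voronoiCell.measurableSet,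
    ae_restrict_of_ae (ae_line_generic (L := L) u),
    ae_restrict_of_ae (ae_notMem_voronoiFace (L := L))] with Z hZ hgen hface
  obtain ⟨δ, hδ, hstep⟩ := exists_step_adjacent hgen
  -- For `N > 1 / δ` the parameters `k / N` and `(k + 1) / N` are close enough for `hstep`.
  have hlim : ∀ᶠ N : ℕ in atTop, ((N : ℝ)⁻¹) < δ :=
    tendsto_inv_atTop_nhds_zero_nat.eventually (gt_mem_nhds hδ)
  filter_upwards [hlim, eventually_gt_atTop 0] with N hN hN0
  have hNpos : (0 : ℝ) < N := by exact_mod_cast hN0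
  obtain ⟨y', hy', p, hp⟩ := exists_walk_length_le_crossingCount
    (w := (N : ℝ)⁻¹ • u) hZ x N (fun k hk c hc c' hc' h1 h2 hne => by
      rw [smul_smul] at h1 h2
      refine hstep (k * (N : ℝ)⁻¹) ⟨by positivity, ?_⟩ (((k + 1 : ℕ) : ℝ) * (N : ℝ)⁻¹) ?_
        c hc c' hc' h1 h2 hne
      · rw [← div_eq_mul_inv, div_le_one hNpos]
        exact_mod_cast hk.le
      · rw [← sub_mul]
        push_cast
        rwa [add_sub_cancel_left, one_mul, abs_of_pos (inv_pos.2 hNpos)]) N le_rfl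
  -- The walk ends at `y`: as `Z` lies in no face, `Z + u` lies in no cell other than that of `u`.
  have hyy : y' = y := by
    by_contra hne
    have hv : (y' : EuclideanSpace ℝ (Fin n)) - y ≠ 0 := sub_ne_zero.2 fun h => hne (Subtype.ext h)
    refine hface _ (L.sub_mem y'.2 y.2) hv
      ((mem_voronoiFace_iff (L.sub_mem y'.2 y.2)).2 ⟨hZ, ?_⟩)
    rw [smul_smul, mul_inv_cancel₀ hNpos.ne', one_smul] at hy'
    convert hy' using 1
    rw [hu]
    abel
  subst hyy
  exact ⟨p, hp⟩

theorem voronoiGraph_reachable (x y : L) : (voronoiGraph L).Reachable x y := by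
  have : (ae (volume.restrict (voronoiCell L))).NeBot := by
    rw [ae_neBot, Ne, Measure.restrict_eq_zero]
    exact volume_voronoiCell_ne_zero
  obtain ⟨Z, hZ⟩ := (ae_eventually_exists_walk x y).exists
  obtain ⟨N, p, -⟩ := hZ.exists
  exact ⟨p⟩

/-- Averaging the crossing counts over a uniform starting point in the cell and letting the step
length tend to zero bounds the graph distance. -/
theorem dist_le_of_sub_mem_smul (x y : L) {b : ℝ} (hb : 0 < b)
    (h : (y : EuclideanSpace ℝ (Fin n)) - x ∈ b • voronoiCell L) :
    ((voronoiGraph L).dist x y : ℝ) ≤ n / 2 * b := by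
  set u := (y : EuclideanSpace ℝ (Fin n)) - x with hu
  set f : ℕ → EuclideanSpace ℝ (Fin n) → ℝ≥0∞ :=
    fun N => crossingCount L ((N : ℝ)⁻¹ • u) N with hf
  have hlow : ((voronoiGraph L).dist x y : ℝ≥0∞) * volume (voronoiCell L) ≤
      ∫⁻ Z in voronoiCell L, liminf (fun N => f N Z) atTop := by
    rw [← setLIntegral_const]
    refine lintegral_mono_ae ?_
    filter_upwards [ae_eventually_exists_walk x y] with Z hZ
    refine le_liminf_of_le (by isBoundedDefault) ?_
    filter_upwards [hZ] with N hN
    obtain ⟨p, hp⟩ := hN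
    exact le_trans (by exact_mod_cast SimpleGraph.dist_le p) hp
  have hup : ∀ᶠ N : ℕ in atTop, ∫⁻ Z in voronoiCell L, f N Z ≤
      ENNReal.ofReal (n / 2 * b) * volume (voronoiCell L) := by
    have hlim : ∀ᶠ N : ℕ in atTop, b / N < 2 :=
      (tendsto_const_div_atTop_nhds_zero_nat b).eventually (gt_mem_nhds two_pos)
    filter_upwards [hlim, eventually_gt_atTop 0] with N hN hN0
    have hNpos : (0 : ℝ) < N := by exact_mod_cast hN0
    have hw : (N : ℝ)⁻¹ • u ∈ (b / N) • voronoiCell L := by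
      obtain ⟨v, hv, hvu⟩ := h
      refine ⟨v, hv, ?_⟩
      simp only at hvu ⊢
      rw [← hvu, smul_smul, div_eq_inv_mul]
    rw [hf, lintegral_crossingCount]
    refine (mul_le_mul_right (volume_crossingSet_le (by positivity) hN.le hw) _).trans ?_
    rw [← mul_assoc, ← ENNReal.ofReal_natCast N, ← ENNReal.ofReal_mul hNpos.le]
    refine le_of_eq ?_
    congr 2
    field_simp
  have hfatou := hlow.trans (lintegral_liminf_le fun N => measurable_crossingCount _ _)
  have hle : ((voronoiGraph L).dist x y : ℝ≥0∞) * volume (voronoiCell L) ≤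
      ENNReal.ofReal (n / 2 * b) * volume (voronoiCell L) :=
    hfatou.trans (liminf_le_of_frequently_le' hup.frequently)
  have := (ENNReal.mul_le_mul_iff_left volume_voronoiCell_ne_zero volume_voronoiCell_ne_top).1 hle
  rw [← ENNReal.ofReal_natCast] at this
  exact (ENNReal.ofReal_le_ofReal_iff (by positivity)).1 this

theorem dist_le_voronoiNorm (x y : L) :
    ((voronoiGraph L).dist x y : ℝ) ≤
      n / 2 * voronoiNorm L ((x : EuclideanSpace ℝ (Fin n)) - y) := by
  refine le_of_forall_pos_le_add fun η hη => ?_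
  obtain ⟨b, hb, hblt, hmem⟩ := exists_lt_of_gauge_lt (absorbent_voronoiCell (L := L))
    (lt_add_of_pos_right (voronoiNorm L ((x : EuclideanSpace ℝ (Fin n)) - y))
      (show 0 < η / (n + 1) by positivity))
  have h := dist_le_of_sub_mem_smul y x hb hmem
  rw [SimpleGraph.dist_comm] at h
  have h1 : (n : ℝ) / 2 * (η / (n + 1)) ≤ η := by
    rw [div_mul_div_comm, div_le_iff₀ (by positivity)]
    nlinarith [mul_nonneg (Nat.cast_nonneg (α := ℝ) n) hη.le]
  calc _ ≤ (n : ℝ) / 2 * b := h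
    _ ≤ n / 2 * (voronoiNorm L ((x : EuclideanSpace ℝ (Fin n)) - y) + η / (n + 1)) := by gcongr
    _ ≤ _ := by rw [mul_add]; linarith

theorem voronoiNorm_le_dist (x y : L) :
    voronoiNorm L ((x : EuclideanSpace ℝ (Fin n)) - y) / 2 ≤ ((voronoiGraph L).dist x y : ℝ) := by
  obtain ⟨p, hp⟩ := (voronoiGraph_reachable x y).exists_walk_length_eq_dist
  rw [← hp]
  linarith [voronoiNorm_le_two_mul_length p]

end Lattice

end Measure

/-! ### The integer lattice -/

section IntegerLattice

open scoped Pointwise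

variable {n : ℕ}

theorem mem_integerLattice_iff {p : EuclideanSpace ℝ (Fin n)} :
    p ∈ integerLattice n ↔ ∀ i, ∃ m : ℤ, (m : ℝ) = p i := by
  rw [Module.Basis.mem_span_iff_repr_mem]
  simp

theorem single_mem_integerLattice (i : Fin n) :
    EuclideanSpace.single i (1 : ℝ) ∈ integerLattice n :=
  Submodule.subset_span ⟨i, by simp⟩

theorem two_mul_mul_intCast_le {a : ℝ} (ha : |a| ≤ 1 / 2) (m : ℤ) : 2 * (a * m) ≤ m * m := by
  have h1 : |(m : ℝ)| ≤ m * m := by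
    rw [← abs_mul_abs_self]
    rcases eq_or_ne m 0 with rfl | hm
    · simp
    · exact le_mul_of_one_le_left (abs_nonneg _) (by exact_mod_cast Int.one_le_abs hm)
  have h2 : a * m ≤ 1 / 2 * |(m : ℝ)| :=
    (le_abs_self _).trans ((abs_mul _ _).le.trans (mul_le_mul_of_nonneg_right ha (abs_nonneg _)))
  linarith

theorem mem_voronoiCell_integerLattice_iff {p : EuclideanSpace ℝ (Fin n)} :
    p ∈ voronoiCell (integerLattice n) ↔ ∀ i, |p i| ≤ 1 / 2 := by
  rw [mem_voronoiCell_iff_inner]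
  constructor
  · intro h i
    have h1 := h _ (single_mem_integerLattice i)
    have h2 := h _ (Submodule.neg_mem _ (single_mem_integerLattice i))
    simp [EuclideanSpace.inner_single_right] at h1 h2
    rw [abs_le]
    constructor <;> linarith
  · intro h y hy
    rw [mem_integerLattice_iff] at hy
    simp only [PiLp.inner_apply, Finset.mul_sum]
    refine Finset.sum_le_sum fun i _ => ?_
    obtain ⟨m, hm⟩ := hy i
    simp only [RCLike.inner_apply, conj_trivial, ← hm]
    linarith [two_mul_mul_intCast_le (h i) m]

theorem single_mem_voronoiRelevant (i : Fin n) :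
    EuclideanSpace.single i (1 : ℝ) ∈ voronoiRelevant (integerLattice n) := by
  set e : EuclideanSpace ℝ (Fin n) := EuclideanSpace.single i (1 : ℝ) with he
  have he0 : e ≠ 0 := by simp [he]
  have hface : ∀ q : EuclideanSpace ℝ (Fin n), q i = 0 → (∀ j, |q j| ≤ 1 / 2) →
      (1 / 2 : ℝ) • e + q ∈ voronoiFace (integerLattice n) e := by
    intro q hq hq'
    refine ⟨mem_voronoiCell_integerLattice_iff.2 fun j => ?_, ?_⟩
    · rcases eq_or_ne j i with rfl | hji
      · simp [he, hq, abs_of_pos]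
      · simpa [he, hji] using hq' j
    · simp [he, EuclideanSpace.inner_single_right, hq]
  have h0 := hface 0 (by simp) (by simp)
  refine ⟨single_mem_integerLattice i, he0, ⟨_, h0⟩, ?_⟩
  suffices h : vectorSpan ℝ (voronoiFace (integerLattice n) e) = (ℝ ∙ e)ᗮ by
    rw [h]; exact finrank_orthogonal_singleton_add_one he0
  refine le_antisymm (vectorSpan_voronoiFace_le e) fun z hz => ?_
  have hzi : z i = 0 := by
    rw [Submodule.mem_orthogonal_singleton_iff_inner_left] at hz
    simpa [he, EuclideanSpace.inner_single_right] using hz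
  -- A small multiple of `z` moves the midpoint `e / 2` inside the face.
  have hs : (0 : ℝ) < 2 * (‖z‖ + 1) := by positivity
  have h1 := hface ((2 * (‖z‖ + 1))⁻¹ • z) (by simp [hzi]) fun j => by
    rw [PiLp.smul_apply, smul_eq_mul, abs_mul, abs_of_pos (inv_pos.2 hs), inv_mul_le_iff₀ hs]
    have : |z j| ≤ ‖z‖ := PiLp.norm_apply_le z j
    linarith
  have h2 := vsub_mem_vectorSpan ℝ h1 h0
  rw [vsub_eq_sub, add_sub_add_left_eq_sub, sub_zero] at h2
  exact (Submodule.smul_mem_iff _ (inv_ne_zero hs.ne')).1 h2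

/-- A Voronoi relevant vector of `ℤⁿ` has a single nonzero coordinate: on its face every coordinate
of its support is fixed, so that two such coordinates would cost two dimensions. -/
theorem eq_of_mem_voronoiRelevant_integerLattice {v : EuclideanSpace ℝ (Fin n)}
    (hv : v ∈ voronoiRelevant (integerLattice n)) {i j : Fin n} (hi : v i ≠ 0) (hj : v j ≠ 0) :
    i = j := by
  by_contra hij
  obtain ⟨hvL, hv0, -, hrank⟩ := hv
  -- The face spans all of `vᗮ`, which contains `v j • e i - v i • e j`, yet
  -- its vectors vanish at `i`.
  have hspan : vectorSpan ℝ (voronoiFace (integerLattice n) v) = (ℝ ∙ v)ᗮ := by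
    refine Submodule.eq_of_le_of_finrank_eq (vectorSpan_voronoiFace_le v) ?_
    have := finrank_orthogonal_singleton_add_one hv0
    omega
  have hfix : ∀ p ∈ voronoiFace (integerLattice n) v, ∀ k, 2 * (p k * v k) = v k * v k := by
    rintro p ⟨hp, hpv⟩
    rw [mem_voronoiCell_integerLattice_iff] at hp
    have hle : ∀ k ∈ Finset.univ, 2 * (p k * v k) ≤ v k * v k := fun k _ => by
      obtain ⟨m, hm⟩ := mem_integerLattice_iff.1 hvL k
      rw [← hm]
      exact two_mul_mul_intCast_le (hp k) m
    -- Summing the inequalities gives the equation of the bisector, so each one is an equality.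
    have hsum : ∑ k, 2 * (p k * v k) = ∑ k, v k * v k := by
      rw [Set.mem_ofPred_eq] at hpv
      simp only [PiLp.inner_apply, RCLike.inner_apply, conj_trivial] at hpv
      rw [← Finset.mul_sum]
      simp_rw [mul_comm (v _) (p _)] at hpv
      linarith
    exact fun k => (Finset.sum_eq_sum_iff_of_le hle).1 hsum k (Finset.mem_univ k)
  have hcoord : ∀ z ∈ vectorSpan ℝ (voronoiFace (integerLattice n) v), z i = 0 := by
    intro z hz
    refine Submodule.span_induction ?_ (by simp) (fun a b _ _ ha hb => by simp [ha, hb])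
      (fun a b _ hb => by simp [hb]) hz
    rintro _ ⟨a, ha, b, hb, rfl⟩
    have h1 := hfix a ha i
    have h2 := hfix b hb i
    have h3 : a i = b i := mul_right_cancel₀ hi (by linarith)
    change a i - b i = 0
    rw [h3, sub_self]
  have hz : EuclideanSpace.single i (v j) - EuclideanSpace.single j (v i) ∈ (ℝ ∙ v)ᗮ := by
    rw [Submodule.mem_orthogonal_singleton_iff_inner_left, inner_sub_left]
    simp [EuclideanSpace.inner_single_left, mul_comm]
  rw [← hspan] at hz
  have := hcoord _ hz
  simp [hij] at this
  exact hj this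

theorem sum_le_one_of_mem_voronoiRelevant {v : EuclideanSpace ℝ (Fin n)}
    (hv : v ∈ voronoiRelevant (integerLattice n)) : ∑ i, v i ≤ 1 := by
  obtain ⟨i, hi⟩ : ∃ i, v i ≠ 0 := by
    by_contra! h
    exact hv.2.1 (by ext i; simp [h i])
  rw [Finset.sum_eq_single i (fun j _ hji => by
    by_contra hj
    exact hji (eq_of_mem_voronoiRelevant_integerLattice hv hj hi)) (by simp)]
  have h := mem_voronoiCell_integerLattice_iff.1 (half_mem_voronoiCell hv) i
  rw [PiLp.smul_apply, smul_eq_mul] at h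
  linarith [(abs_le.1 h).2]

theorem sum_sub_le_length {x y : integerLattice n}
    (p : (voronoiGraph (integerLattice n)).Walk x y) :
    ∑ i, ((x : EuclideanSpace ℝ (Fin n)) - y) i ≤ p.length := by
  induction p with
  | nil => simp
  | @cons x z y h p ih =>
    have h1 := sum_le_one_of_mem_voronoiRelevant h
    simp only [PiLp.sub_apply, Finset.sum_sub_distrib] at h1 ih ⊢
    rw [SimpleGraph.Walk.length_cons]
    push_cast
    linarith

theorem two_le_voronoiNorm_single (i : Fin n) :
    2 ≤ voronoiNorm (integerLattice n) (EuclideanSpace.single i 1) := by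
  by_contra! h
  obtain ⟨b, hb, hb2, v, hv, hvb⟩ := exists_lt_of_gauge_lt absorbent_voronoiCell h
  have h1 := (abs_le.1 (mem_voronoiCell_integerLattice_iff.1 hv i)).2
  have h2 : b * v i = 1 := by
    have := congrArg (fun z : EuclideanSpace ℝ (Fin n) => z i) hvb
    simpa using this
  nlinarith

/-- The lower bound is attained at a standard basis vector. -/
theorem dist_single_zero_eq (i : Fin n) :
    ((voronoiGraph (integerLattice n)).dist
        ⟨EuclideanSpace.single i 1, single_mem_integerLattice i⟩ 0 : ℝ) =
      voronoiNorm (integerLattice n) (EuclideanSpace.single i 1) / 2 := by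
  have hrel := single_mem_voronoiRelevant i
  have hadj : (voronoiGraph (integerLattice n)).Adj
      ⟨EuclideanSpace.single i 1, single_mem_integerLattice i⟩ 0 := by
    change EuclideanSpace.single i (1 : ℝ) - 0 ∈ voronoiRelevant (integerLattice n)
    rwa [sub_zero]
  rw [SimpleGraph.dist_eq_one_iff_adj.2 hadj, le_antisymm
    (voronoiNorm_le_two (half_mem_voronoiCell hrel)) (two_le_voronoiNorm_single i)]
  norm_num

theorem ones_mem_integerLattice :
    (WithLp.toLp 2 fun _ => 1 : EuclideanSpace ℝ (Fin n)) ∈ integerLattice n :=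
  mem_integerLattice_iff.2 fun _ => ⟨1, by simp⟩

/-- The upper bound is attained at the all-ones vector. -/
theorem dist_ones_zero_eq :
    ((voronoiGraph (integerLattice n)).dist ⟨_, ones_mem_integerLattice⟩ 0 : ℝ) =
      n / 2 * voronoiNorm (integerLattice n) (WithLp.toLp 2 fun _ => 1) := by
  have hup := dist_le_voronoiNorm (L := integerLattice n) ⟨_, ones_mem_integerLattice⟩ 0
  rw [ZeroMemClass.coe_zero, sub_zero] at hup
  refine le_antisymm hup ?_
  have hnorm : voronoiNorm (integerLattice n) (WithLp.toLp 2 fun _ => 1) ≤ 2 :=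
    voronoiNorm_le_two (mem_voronoiCell_integerLattice_iff.2 fun i => by simp [abs_of_pos])
  obtain ⟨p, hp⟩ := (voronoiGraph_reachable (L := integerLattice n)
    ⟨_, ones_mem_integerLattice⟩ 0).exists_walk_length_eq_dist
  have hlow := sum_sub_le_length p
  rw [hp] at hlow
  have hsum : (n : ℝ) ≤ (voronoiGraph (integerLattice n)).dist ⟨_, ones_mem_integerLattice⟩ 0 := by
    simpa using hlow
  refine le_trans ?_ hsum
  calc (n : ℝ) / 2 * voronoiNorm (integerLattice n) (WithLp.toLp 2 fun _ => 1)
      ≤ n / 2 * 2 := by gcongr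
    _ = n := by ring

end IntegerLattice

theorem mainTheorem2 (n : ℕ) (hn : 1 ≤ n) :
    (∀ (L : Submodule ℤ (EuclideanSpace ℝ (Fin n))) [DiscreteTopology L] [IsZLattice ℝ L]
      (x y : L),
      (voronoiGraph L).Reachable x y ∧
      voronoiNorm L ((x : EuclideanSpace ℝ (Fin n)) - y) / 2 ≤ ((voronoiGraph L).dist x y : ℝ) ∧
      ((voronoiGraph L).dist x y : ℝ) ≤
        (n : ℝ) / 2 * voronoiNorm L ((x : EuclideanSpace ℝ (Fin n)) - y)) ∧
    (∃ x y : integerLattice n, x ≠ y ∧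
      ((voronoiGraph (integerLattice n)).dist x y : ℝ) =
        voronoiNorm (integerLattice n) ((x : EuclideanSpace ℝ (Fin n)) - y) / 2) ∧
    (∃ x y : integerLattice n, x ≠ y ∧
      ((voronoiGraph (integerLattice n)).dist x y : ℝ) =
        (n : ℝ) / 2 * voronoiNorm (integerLattice n) ((x : EuclideanSpace ℝ (Fin n)) - y)) := by
  refine ⟨fun L _ _ x y => ⟨voronoiGraph_reachable x y, voronoiNorm_le_dist x y,
    dist_le_voronoiNorm x y⟩, ⟨⟨_, single_mem_integerLattice ⟨0, hn⟩⟩, 0, ?_, ?_⟩,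
    ⟨⟨_, ones_mem_integerLattice⟩, 0, ?_, ?_⟩⟩
  · intro h
    simpa using congrArg Subtype.val h
  · rw [dist_single_zero_eq, ZeroMemClass.coe_zero, sub_zero]
  · intro h
    simpa using congrArg (fun z : integerLattice n => (z : EuclideanSpace ℝ (Fin n)) ⟨0, hn⟩) h
  · rw [dist_ones_zero_eq, ZeroMemClass.coe_zero, sub_zero]
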